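/- Let $r,s\ge 3$ be odd integers and let $\ell\ge 1$ be an even integer. Let $D_{r,s,\ell}$ be the dumbbell graph obtained from two vertex-disjoint cycles $C_r$ and $C_s$ by choosing one vertex on each and joining these two vertices by a path of length $\ell$. A complex unit gain graph $\Phi$ on $D_{r,s,\ell}$ is a function $\varphi$ that assigns to each oriented edge $(u,v)$ a complex number of modulus $1$ with $\varphi(v,u)=\varphi(u,v)^{-1}$; its energy $E(\Phi)$ is the sum of the absolute values of the eigenvalues, counted with multiplicity, of the Hermitian matrix $A(\Phi)$ with entries $A(\Phi)_{uv}=\varphi(u,v)$ if $u\sim v$ and $A(\Phi)_{uv}=0$ otherwise. Let $\gamma_r,\gamma_s$ be the products of the gains along the oriented cycles $C_r$ and $C_s$ (the real parts do not depend on the orientations), and put $$\alpha=(-1)^{(r+1)/2}\operatorname{Re}\gamma_r,\qquad \beta=(-1)^{(s+1)/2}\operatorname{Re}\gamma_s .$$ Then the minimum of $E(\Phi)$ over all complex unit gain graphs $\Phi$ on $D_{r,s,\ell}$ is attained, and it is attained exactly at those $\Phi$ for which $(\alpha,\beta)=(0,0)$, that is, for which both cycle gains $\gamma_r,\gamma_s$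 are purely imaginary. -/

import Mathlib

/-- A complex unit gain graph on the simple graph `G`: every oriented edge carries a complex
number of modulus one, and reversing the orientation inverts it. -/
structure UnitGainGraph {V : Type*} (G : SimpleGraph V) where
  gain : G.Dart → Circle
  gain_symm : ∀ d : G.Dart, gain d.symm = (gain d)⁻¹

namespace UnitGainGraph

open Classical in
/-- The Hermitian adjacency matrix: the entry `(u, v)` is the gain of the oriented edge from `u`
to `v`, and `0` if `u` and `v` are not adjacent. -/
noncomputable def adjMatrix {V : Type*} {G : SimpleGraph V} (Φ : UnitGainGraph G) :
    Matrix V V ℂ :=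
  Matrix.of fun u v => if h : G.Adj u v then ((Φ.gain ⟨(u, v), h⟩ : Circle) : ℂ) else 0

theorem adjMatrix_isHermitian {V : Type*} {G : SimpleGraph V} (Φ : UnitGainGraph G) :
    Φ.adjMatrix.IsHermitian := by
  ext u v
  simp only [Matrix.conjTranspose_apply, adjMatrix, Matrix.of_apply]
  by_cases h : G.Adj u v
  · have h2 : G.Adj v u := h.symm
    have h3 : Φ.gain ⟨(v, u), h2⟩ = (Φ.gain ⟨(u, v), h⟩)⁻¹ := Φ.gain_symm ⟨(u, v), h⟩
    rw [dif_pos h, dif_pos h2, h3, Circle.coe_inv_eq_conj]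
    simp
  · have h2 : ¬ G.Adj v u := fun h2 => h h2.symm
    rw [dif_neg h, dif_neg h2]
    simp

/-- The energy: the sum of the absolute values of the eigenvalues (with multiplicity) of the
Hermitian adjacency matrix. -/
noncomputable def energy {V : Type*} [Fintype V] [DecidableEq V] {G : SimpleGraph V}
    (Φ : UnitGainGraph G) : ℝ :=
  ∑ j, |Φ.adjMatrix_isHermitian.eigenvalues j|

end UnitGainGraph

/-- The vertices of the dumbbell graph: those of the cycle `C_r`, the `ℓ - 1` inner vertices of
the joining path, and those of the cycle `C_s`. -/
abbrev DumbbellVertex (r s ℓ : ℕ) : Type := Fin r ⊕ Fin (ℓ - 1) ⊕ Fin s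

/-- Adjacency in the dumbbell graph: the two cycles, the path on the inner vertices, and the
edges joining the ends of that path to vertex `0` of either cycle. If `ℓ = 1` there is no inner
vertex, and the two vertices `0` are joined directly. -/
def dumbbellAdj (r s ℓ : ℕ) : DumbbellVertex r s ℓ → DumbbellVertex r s ℓ → Prop
  | .inl i, .inl j => (SimpleGraph.cycleGraph r).Adj i j
  | .inr (.inl i), .inr (.inl j) => (SimpleGraph.pathGraph (ℓ - 1)).Adj i j
  | .inr (.inr i), .inr (.inr j) => (SimpleGraph.cycleGraph s).Adj i j
  | .inl i, .inr (.inl k) => i.val = 0 ∧ k.val = 0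
  | .inr (.inl k), .inl i => i.val = 0 ∧ k.val = 0
  | .inr (.inl k), .inr (.inr j) => k.val + 1 = ℓ - 1 ∧ j.val = 0
  | .inr (.inr j), .inr (.inl k) => k.val + 1 = ℓ - 1 ∧ j.val = 0
  | .inl i, .inr (.inr j) => ℓ = 1 ∧ i.val = 0 ∧ j.val = 0
  | .inr (.inr j), .inl i => ℓ = 1 ∧ i.val = 0 ∧ j.val = 0

/-- The dumbbell graph `D_{r,s,ℓ}` (for `r, s ≥ 3` and `ℓ ≥ 1`): two vertex disjoint cycles of
lengths `r` and `s`, a vertex of the one joined to a vertex of the other by a path of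
length `ℓ`. -/
def dumbbellGraph (r s ℓ : ℕ) : SimpleGraph (DumbbellVertex r s ℓ) where
  Adj := dumbbellAdj r s ℓ
  symm := ⟨by
    rintro (i | i | i) (j | j | j) h
    all_goals first
      | exact h
      | exact SimpleGraph.Adj.symm h⟩
  loopless := ⟨by
    rintro (i | i | i) h
    all_goals exact SimpleGraph.irrefl _ h⟩

namespace Dumbbell

/-- The gain of the cycle `C_r`: the product of the gains of the oriented edges
`0 → 1 → ⋯ → r - 1 → 0`. The other orientation gives the complex conjugate. -/
noncomputable def gammaR {r s ℓ : ℕ} (Φ : UnitGainGraph (dumbbellGraph r s ℓ)) : ℂ :=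
  ∏ i : Fin r, Φ.adjMatrix (.inl i) (.inl (finRotate r i))

/-- The gain of the cycle `C_s`: the product of the gains of the oriented edges
`0 → 1 → ⋯ → s - 1 → 0`. -/
noncomputable def gammaS {r s ℓ : ℕ} (Φ : UnitGainGraph (dumbbellGraph r s ℓ)) : ℂ :=
  ∏ j : Fin s, Φ.adjMatrix (.inr (.inr j)) (.inr (.inr (finRotate s j)))

/-- `α = δ_r Re γ_r` with `δ_r = (-1)^((r+1)/2)`, for odd `r`. -/
noncomputable def alpha {r s ℓ : ℕ} (Φ : UnitGainGraph (dumbbellGraph r s ℓ)) : ℝ :=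
  (-1) ^ ((r + 1) / 2) * (gammaR Φ).re

/-- `β = δ_s Re γ_s` with `δ_s = (-1)^((s+1)/2)`, for odd `s`. -/
noncomputable def beta {r s ℓ : ℕ} (Φ : UnitGainGraph (dumbbellGraph r s ℓ)) : ℝ :=
  (-1) ^ ((s + 1) / 2) * (gammaS Φ).re

end Dumbbell

/-! For a Hermitian matrix A with eigenvalues λ, |det (t + iA)|² = ∏ (λ² + t²). In the spirit of
Coulson's integral formula, if this product is smaller for one matrix than for another of the same
size at every t > 0, then so is the sum of the |λ|. It therefore suffices to minimise the
determinant pointwise in t.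

Eliminating both cycles by Schur complements leaves the tridiagonal matrix of the inner path,
perturbed at its two ends. Everything is then expressed through Fibonacci polynomials F_n(t),
positive for n ≥ 1. An odd cycle enters through its determinant g - 2iα, where g > 0 does not depend
on the gains.

Expanding (`normSq_expand`), |det|² is the square of a gain-free term, plus 16(αβF_ℓ)², plus a
quadratic form 4(αA)² + 4(βB)² + 8αβc with c = F_r F_s (F_{ℓ-1}² - F_ℓ F_{ℓ-2}). By Cassini's
identity the bracket is (-1)^ℓ = 1, and then AB - c > 0, so the form is positive definite. Hence the
product is minimal exactly at (α, β) = (0, 0), a value realised by giving every edge the gain ±i. -/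

/-- The Fibonacci polynomials, evaluated at `t`. -/
def fibPoly {R : Type*} [Semiring R] (t : R) : ℕ → R
  | 0 => 0
  | 1 => 1
  | n + 2 => t * fibPoly t (n + 1) + fibPoly t n

theorem fibPoly_add_two {R : Type*} [Semiring R] (t : R) (n : ℕ) :
    fibPoly t (n + 2) = t * fibPoly t (n + 1) + fibPoly t n := rfl

theorem fibPoly_succ_pos {t : ℝ} (ht : 0 < t) (n : ℕ) : 0 < fibPoly t (n + 1) := by
  induction n using Nat.twoStepInduction with
  | zero => simp [fibPoly]
  | one => simpa [fibPoly] using ht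
  | more n h1 h2 => rw [fibPoly_add_two]; positivity

theorem fibPoly_nonneg {t : ℝ} (ht : 0 < t) (n : ℕ) : 0 ≤ fibPoly t n := by
  cases n with
  | zero => simp [fibPoly]
  | succ n => exact (fibPoly_succ_pos ht n).le

theorem fibPoly_ofReal (t : ℝ) (n : ℕ) : fibPoly (t : ℂ) n = (fibPoly t n : ℝ) := by
  induction n using Nat.twoStepInduction with
  | zero => simp [fibPoly]
  | one => simp [fibPoly]
  | more n h1 h2 => rw [fibPoly_add_two, fibPoly_add_two, h1, h2]; push_cast; rfl

/-- Cassini's identity for Fibonacci polynomials. -/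
theorem fibPoly_cassini {R : Type*} [CommRing R] (t : R) (n : ℕ) :
    fibPoly t (n + 1) ^ 2 - fibPoly t (n + 2) * fibPoly t n = (-1) ^ n := by
  induction n with
  | zero => simp [fibPoly]
  | succ n ih =>
    rw [pow_succ (-1), ← ih, fibPoly_add_two t (n + 1), fibPoly_add_two t n]; ring

/-! ### Determinants of tridiagonal and cyclic matrices -/

namespace Matrix

variable {R : Type*} [CommRing R]

theorem det_eq_of_first_row_col_sparse {n : ℕ} (M : Matrix (Fin (n + 2)) (Fin (n + 2)) R)
    (hrow : ∀ j : Fin n, M 0 j.succ.succ = 0) (hcol : ∀ j : Fin n, M j.succ.succ 0 = 0) :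
    M.det = M 0 0 * (M.submatrix Fin.succ Fin.succ).det
      - M 0 1 * M 1 0 * (M.submatrix (Fin.succ ∘ Fin.succ) (Fin.succ ∘ Fin.succ)).det := by
  have hcomp : ((1 : Fin (n + 2)).succAbove ∘ Fin.succ) = (Fin.succ ∘ Fin.succ : Fin n → _) := by
    funext i
    exact Fin.succ_succAbove_succ 0 i
  have hinner : (M.submatrix Fin.succ (1 : Fin (n + 2)).succAbove).det =
      M 1 0 * (M.submatrix (Fin.succ ∘ Fin.succ) (Fin.succ ∘ Fin.succ)).det := by
    rw [det_succ_column_zero, Fin.sum_univ_succ]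
    simp [hcol, hcomp, Matrix.submatrix_submatrix]
  rw [det_succ_row_zero, Fin.sum_univ_succ, Fin.sum_univ_succ]
  simp [hrow, hinner]
  ring

/-- Vanishing off the three central diagonals. -/
def IsTridiagonal {n : ℕ} (M : Matrix (Fin n) (Fin n) R) : Prop :=
  ∀ i j : Fin n, i.val + 1 < j.val ∨ j.val + 1 < i.val → M i j = 0

theorem IsTridiagonal.det_add_two {n : ℕ} {M : Matrix (Fin (n + 2)) (Fin (n + 2)) R}
    (hM : M.IsTridiagonal) :
    M.det = M 0 0 * (M.submatrix Fin.succ Fin.succ).det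
      - M 0 1 * M 1 0 * (M.submatrix (Fin.succ ∘ Fin.succ) (Fin.succ ∘ Fin.succ)).det :=
  det_eq_of_first_row_col_sparse M (fun j => hM _ _ (by simp)) (fun j => hM _ _ (by simp))

theorem IsTridiagonal.submatrix_succ {n : ℕ} {M : Matrix (Fin (n + 1)) (Fin (n + 1)) R}
    (hM : M.IsTridiagonal) : (M.submatrix Fin.succ Fin.succ).IsTridiagonal :=
  fun i j h => hM _ _ (by simpa using h)

/-- Expansion at the first vertex is the Fibonacci recurrence, since opposite off-diagonal entries
multiply to -1. The perturbation y sits at the other end, so it survives the induction. -/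
theorem IsTridiagonal.det_eq_fibPoly {n : ℕ} {M : Matrix (Fin n) (Fin n) R}
    (hM : M.IsTridiagonal) {t y : R}
    (hdiag : ∀ i, M i i = t + if i.val + 1 = n then y else 0)
    (hoff : ∀ i j : Fin n, i.val + 1 = j.val → M i j * M j i = -1) :
    M.det = fibPoly t (n + 1) + y * fibPoly t n := by
  induction n using Nat.twoStepInduction with
  | zero => simp [fibPoly]
  | one => simp [fibPoly, hdiag]
  | more n h1 h2 =>
    have e1 := h2 hM.submatrix_succ (fun i => by simp [hdiag])
      (fun i j h => hoff _ _ (by simpa using h))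
    have e2 := h1 hM.submatrix_succ.submatrix_succ (fun i => by simp [hdiag])
      (fun i j h => hoff _ _ (by simpa using h))
    rw [submatrix_submatrix] at e2
    rw [hM.det_add_two, e1, e2, hoff 0 1 (by simp), hdiag, fibPoly_add_two t (n + 1),
      fibPoly_add_two t n]
    simp
    ring

theorem IsTridiagonal.det_eq_fibPoly_of_ends {n : ℕ} {M : Matrix (Fin (n + 1)) (Fin (n + 1)) R}
    (hM : M.IsTridiagonal) {t x y : R}
    (hdiag : ∀ i, M i i = t + (if i.val = 0 then x else 0) + if i.val = n then y else 0)
    (hoff : ∀ i j : Fin (n + 1), i.val + 1 = j.val → M i j * M j i = -1) :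
    M.det = fibPoly t (n + 2) + (x + y) * fibPoly t (n + 1) + x * y * fibPoly t n := by
  cases n with
  | zero => simp [fibPoly, hdiag]; ring
  | succ n =>
    have e1 := hM.submatrix_succ.det_eq_fibPoly (t := t) (y := y) (fun i => by simp [hdiag])
      (fun i j h => hoff _ _ (by simpa using h))
    have e2 := hM.submatrix_succ.submatrix_succ.det_eq_fibPoly (t := t) (y := y)
      (fun i => by simp [hdiag]) (fun i j h => hoff _ _ (by simpa using h))
    rw [submatrix_submatrix] at e2
    rw [hM.det_add_two, e1, e2, hoff 0 1 (by simp), hdiag, fibPoly_add_two t (n + 1),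
      fibPoly_add_two t n]
    simp
    ring

/-- The determinant of a tridiagonal matrix with two additional corner entries. -/
theorem det_cyclic_eq_fibPoly {n : ℕ} (M : Matrix (Fin (n + 3)) (Fin (n + 3)) R) {t : R}
    (hzero : ∀ i j : Fin (n + 3), i.val + 1 < j.val → (i ≠ 0 ∨ j ≠ Fin.last _) →
      M i j = 0 ∧ M j i = 0)
    (hdiag : ∀ i, M i i = t)
    (hoff : ∀ i j : Fin (n + 3), i.val + 1 = j.val → M i j * M j i = -1)
    (hcorner : M 0 (Fin.last _) * M (Fin.last _) 0 = -1) :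
    M.det = t * fibPoly t (n + 3) + 2 * fibPoly t (n + 2) + (-1) ^ n *
      ((∏ i : Fin (n + 2), M i.castSucc i.succ) * M (Fin.last _) 0 +
        (∏ i : Fin (n + 2), M i.succ i.castSucc) * M 0 (Fin.last _)) := by
  have tri1 : (M.submatrix Fin.succ Fin.succ).IsTridiagonal := by
    rintro i j (h | h)
    · exact (hzero i.succ j.succ (by simpa using h) (by simp)).1
    · exact (hzero j.succ i.succ (by simpa using h) (by simp)).2
  have d1 := tri1.det_eq_fibPoly (t := t) (y := 0) (fun i => by simp [hdiag])
      (fun i j h => hoff _ _ (by simpa using h))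
  have d2 := tri1.submatrix_succ.det_eq_fibPoly (t := t) (y := 0) (fun i => by simp [hdiag])
      (fun i j h => hoff _ _ (by simpa using h))
  have tri3 : (M.submatrix (Fin.succ ∘ Fin.castSucc) (Fin.succ ∘ Fin.castSucc) :
      Matrix (Fin (n + 1)) (Fin (n + 1)) R).IsTridiagonal := fun i j h =>
    tri1 i.castSucc j.castSucc (by simpa using h)
  have d3 := tri3.det_eq_fibPoly (t := t) (y := 0) (fun i => by simp [hdiag])
      (fun i j h => hoff _ _ (by simpa using h))
  -- Deleting opposite ends from rows and columns leaves a triangular matrix; its diagonal is the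
  -- product of the edges in one direction, which is where the gain of the cycle comes from.
  have d4 : (M.submatrix (Fin.succ ∘ Fin.castSucc) (Fin.succ ∘ Fin.succ) :
      Matrix (Fin (n + 1)) (Fin (n + 1)) R).det =
      ∏ i : Fin (n + 1), M i.succ.castSucc i.succ.succ := by
    rw [det_of_isLowerTriangular]
    · rfl
    · intro i j h
      have h' : i < j := h
      exact tri1 i.castSucc j.succ (Or.inl (by simpa using h'))
  have d5 : (M.submatrix (Fin.succ ∘ Fin.succ) (Fin.succ ∘ Fin.castSucc) :
      Matrix (Fin (n + 1)) (Fin (n + 1)) R).det =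
      ∏ i : Fin (n + 1), M i.succ.succ i.succ.castSucc := by
    rw [det_of_isUpperTriangular]
    · rfl
    · intro i j h
      have h' : j < i := h
      exact tri1 i.succ j.castSucc (Or.inr (by simpa using h'))
  have col0 : ∀ i : Fin n, M i.castSucc.succ.succ 0 = 0 := fun i =>
    (hzero 0 i.castSucc.succ.succ (by simp) (Or.inr (by
      rw [Ne, Fin.ext_iff]; simp; omega))).2
  have row0 : ∀ i : Fin n, M 0 i.castSucc.succ.succ = 0 := fun i =>
    (hzero 0 i.castSucc.succ.succ (by simp) (Or.inr (by
      rw [Ne, Fin.ext_iff]; simp; omega))).1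
  -- Below row 0, column 0 is supported on rows 1 and `Fin.last`. The same expansion serves the
  -- minors with column 1 and with the last column removed.
  have expand : ∀ c : Fin (n + 2) → Fin (n + 3), c 0 = 0 →
      (M.submatrix Fin.succ c).det =
        M 1 0 * (M.submatrix (Fin.succ ∘ Fin.succ) (c ∘ Fin.succ)).det +
        (-1) ^ (n + 1) * M (Fin.last _) 0 *
          (M.submatrix (Fin.succ ∘ Fin.castSucc) (c ∘ Fin.succ)).det := by
    intro c hc
    rw [det_succ_column_zero, Fin.sum_univ_succ, Fin.sum_univ_castSucc]
    simp [hc, col0, Matrix.submatrix_submatrix]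
  have e1 := expand (Fin.succ 0).succAbove (by simp)
  have e2 := expand (Fin.last _).succAbove (by simp)
  have c1 : ((Fin.succ 0 : Fin (n + 3)).succAbove ∘ Fin.succ) = Fin.succ ∘ Fin.succ := by
    funext i
    exact Fin.succ_succAbove_succ 0 i
  have c2 : ((Fin.last (n + 2)).succAbove ∘ Fin.succ) = (Fin.succ ∘ Fin.castSucc) := by
    funext i
    simp
  rw [c1, d4] at e1
  rw [c2, d3, d5] at e2
  rw [submatrix_submatrix] at d2
  rw [d2] at e1
  have h01 := hoff 0 1 (by simp)
  have hexp : M.det = M 0 0 * (M.submatrix Fin.succ Fin.succ).det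
      - M 0 1 * (M.submatrix Fin.succ (Fin.succ 0).succAbove).det
      + (-1) ^ n * M 0 (Fin.last _) * (M.submatrix Fin.succ (Fin.last _).succAbove).det := by
    rw [det_succ_row_zero, Fin.sum_univ_succ, Fin.sum_univ_succ, Fin.sum_univ_castSucc]
    simp only [row0]
    simp
    ring
  have p1 : ∏ i : Fin (n + 2), M i.castSucc i.succ =
      M 0 1 * ∏ i : Fin (n + 1), M i.succ.castSucc i.succ.succ := Fin.prod_univ_succ _
  have p2 : ∏ i : Fin (n + 2), M i.succ i.castSucc =
      M 1 0 * ∏ i : Fin (n + 1), M i.succ.succ i.succ.castSucc := Fin.prod_univ_succ _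
  have hsq : ((-1 : R) ^ n) * (-1) ^ n = 1 := by rw [← mul_pow]; simp
  rw [hexp, e1, e2, d1, hdiag, p1, p2]
  linear_combination (-fibPoly t (n + 2)) * h01 - fibPoly t (n + 2) * hcorner -
    fibPoly t (n + 2) * M 0 (Fin.last _) * M (Fin.last _) 0 * hsq

end Matrix

/-! ### Coulson's comparison, without improper integrals -/

section LogPrimitive

open Filter Topology

/-- An antiderivative of `t ↦ log (a ^ 2 + t ^ 2) + 2`. -/
noncomputable def logPrimitive (a t : ℝ) : ℝ :=
  t * Real.log (a ^ 2 + t ^ 2) + 2 * (a * Real.arctan (t / a))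

theorem hasDerivAt_logPrimitive (a : ℝ) {t : ℝ} (ht : 0 < t) :
    HasDerivAt (logPrimitive a) (Real.log (a ^ 2 + t ^ 2) + 2) t := by
  have hpos : 0 < a ^ 2 + t ^ 2 := by positivity
  have h1 : HasDerivAt (fun t : ℝ => a ^ 2 + t ^ 2) (2 * t) t := by
    simpa using (hasDerivAt_pow 2 t).const_add (a ^ 2)
  have h2 := (hasDerivAt_id t).mul (h1.log hpos.ne')
  have h3 := (((hasDerivAt_id t).div_const a).arctan.const_mul a).const_mul 2
  refine (h2.add h3).congr_deriv ?_
  -- For a = 0 the arctangent term vanishes, and log (t²) alone already gives the constant 2.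
  rcases eq_or_ne a 0 with rfl | ha
  · simp
    field_simp
  · simp
    field_simp
    ring

theorem continuous_logPrimitive (a : ℝ) : Continuous (logPrimitive a) := by
  unfold logPrimitive
  refine Continuous.add ?_ (by fun_prop)
  rcases eq_or_ne a 0 with rfl | ha
  · have : (fun t : ℝ => t * Real.log (0 ^ 2 + t ^ 2)) = fun t => 2 * (t * Real.log t) := by
      funext t
      simp
      ring
    rw [this]
    exact Real.continuous_mul_log.const_mul 2
  · refine continuous_id.mul (Continuous.log (by fun_prop) fun t => ?_)
    positivity

theorem logPrimitive_zero (a : ℝ) : logPrimitive a 0 = 0 := by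
  simp [logPrimitive]

/-- The logarithm contributes 2 t log t up to an error of at most a²/t, and the arctangent tends to
±π/2 with the sign of a. This recovers |a| from the primitive. -/
theorem tendsto_logPrimitive_sub (a : ℝ) :
    Tendsto (fun t => logPrimitive a t - 2 * (t * Real.log t)) atTop (𝓝 (Real.pi * |a|)) := by
  have hlog : Tendsto (fun t : ℝ => t * Real.log (1 + a ^ 2 / t ^ 2)) atTop (𝓝 0) := by
    have hup : Tendsto (fun t : ℝ => a ^ 2 / t) atTop (𝓝 0) := tendsto_const_nhds.div_atTop tendsto_id
    refine tendsto_of_tendsto_of_tendsto_of_le_of_le' tendsto_const_nhds hup ?_ ?_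
    · filter_upwards [eventually_gt_atTop 0] with t ht
      exact mul_nonneg ht.le (Real.log_nonneg (by simp; positivity))
    · filter_upwards [eventually_gt_atTop 0] with t ht
      have h := Real.log_le_sub_one_of_pos (show 0 < 1 + a ^ 2 / t ^ 2 by positivity)
      calc t * Real.log (1 + a ^ 2 / t ^ 2) ≤ t * (1 + a ^ 2 / t ^ 2 - 1) := by gcongr
        _ = a ^ 2 / t := by field_simp; ring
  have harc : Tendsto (fun t : ℝ => 2 * (a * Real.arctan (t / a))) atTop (𝓝 (Real.pi * |a|)) := by
    rcases lt_trichotomy a 0 with ha | rfl | ha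
    · have h := (Real.tendsto_arctan_atBot.mono_right nhdsWithin_le_nhds).comp
        (tendsto_id.atTop_div_const_of_neg ha)
      refine ((h.const_mul a).const_mul 2).trans (le_of_eq ?_)
      congr 1
      rw [abs_of_neg ha]; ring
    · simp
    · have h := (Real.tendsto_arctan_atTop.mono_right nhdsWithin_le_nhds).comp
        (tendsto_id.atTop_div_const ha)
      refine ((h.const_mul a).const_mul 2).trans (le_of_eq ?_)
      congr 1
      rw [abs_of_pos ha]; ring
  have hsum := hlog.add harc
  rw [zero_add] at hsum
  refine hsum.congr' ?_
  filter_upwards [eventually_gt_atTop 0] with t ht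
  have hsplit : a ^ 2 + t ^ 2 = t ^ 2 * (1 + a ^ 2 / t ^ 2) := by field_simp; ring
  rw [logPrimitive, hsplit, Real.log_mul (by positivity) (by positivity), Real.log_pow]
  push_cast
  ring

section Comparison

variable {ι : Type*} [Fintype ι] (a b : ι → ℝ)

theorem hasDerivAt_sum_logPrimitive_sub {t : ℝ} (ht : 0 < t) :
    HasDerivAt (fun t => ∑ i, (logPrimitive (b i) t - logPrimitive (a i) t))
      (Real.log (∏ i, (b i ^ 2 + t ^ 2)) - Real.log (∏ i, (a i ^ 2 + t ^ 2))) t := by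
  rw [Real.log_prod (fun i _ => by positivity), Real.log_prod (fun i _ => by positivity),
    ← Finset.sum_sub_distrib]
  refine HasDerivAt.fun_sum fun i _ => ?_
  exact ((hasDerivAt_logPrimitive (b i) ht).sub (hasDerivAt_logPrimitive (a i) ht)).congr_deriv
    (by ring)

theorem continuous_sum_logPrimitive_sub :
    Continuous fun t => ∑ i, (logPrimitive (b i) t - logPrimitive (a i) t) :=
  continuous_finsetSum _ fun i _ => (continuous_logPrimitive (b i)).sub (continuous_logPrimitive (a i))

theorem tendsto_sum_logPrimitive_sub :
    Tendsto (fun t => ∑ i, (logPrimitive (b i) t - logPrimitive (a i) t)) atTop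
      (𝓝 (Real.pi * (∑ i, |b i| - ∑ i, |a i|))) := by
  rw [← Finset.sum_sub_distrib, Finset.mul_sum]
  refine tendsto_finsetSum _ fun i _ => ?_
  have h := (tendsto_logPrimitive_sub (b i)).sub (tendsto_logPrimitive_sub (a i))
  rw [← mul_sub] at h
  -- The divergent terms 2 t log t cancel because both families have the same index type.
  exact h.congr fun t => by ring

variable {a b}

/-- The difference of the primitives is 0 at t = 0, has derivative the difference of the logarithms
of the products, and tends to π times the difference of the two sums. -/
theorem sum_abs_le_of_prod_sq_add_sq_le
    (h : ∀ t : ℝ, 0 < t → ∏ i, (a i ^ 2 + t ^ 2) ≤ ∏ i, (b i ^ 2 + t ^ 2)) :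
    ∑ i, |a i| ≤ ∑ i, |b i| := by
  have hmono : MonotoneOn (fun t => ∑ i, (logPrimitive (b i) t - logPrimitive (a i) t))
      (Set.Ici 0) := by
    refine monotoneOn_of_deriv_nonneg (convex_Ici 0)
      (continuous_sum_logPrimitive_sub a b).continuousOn ?_ ?_ <;> rw [interior_Ici]
    · exact fun t ht =>
        (hasDerivAt_sum_logPrimitive_sub a b ht).differentiableAt.differentiableWithinAt
    · intro t ht
      have ht' : 0 < t := ht
      rw [(hasDerivAt_sum_logPrimitive_sub a b ht').deriv]
      exact sub_nonneg.2 (Real.log_le_log (Finset.prod_pos fun i _ => by positivity) (h t ht'))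
  have hlim := ge_of_tendsto (tendsto_sum_logPrimitive_sub a b)
    ((eventually_ge_atTop 0).mono fun t ht => hmono Set.self_mem_Ici ht ht)
  simp only [logPrimitive_zero, sub_zero, Finset.sum_const_zero] at hlim
  exact sub_nonneg.1 (nonneg_of_mul_nonneg_right hlim Real.pi_pos)

theorem sum_abs_lt_of_prod_sq_add_sq_lt
    (h : ∀ t : ℝ, 0 < t → ∏ i, (a i ^ 2 + t ^ 2) < ∏ i, (b i ^ 2 + t ^ 2)) :
    ∑ i, |a i| < ∑ i, |b i| := by
  have hmono : StrictMonoOn (fun t => ∑ i, (logPrimitive (b i) t - logPrimitive (a i) t))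
      (Set.Ici 0) := by
    refine strictMonoOn_of_deriv_pos (convex_Ici 0)
      (continuous_sum_logPrimitive_sub a b).continuousOn ?_
    intro t ht
    rw [interior_Ici] at ht
    have ht' : 0 < t := ht
    rw [(hasDerivAt_sum_logPrimitive_sub a b ht').deriv]
    exact sub_pos.2 (Real.log_lt_log (Finset.prod_pos fun i _ => by positivity) (h t ht'))
  -- Strictness could be lost in the limit, so the limit is bounded below by the positive value at t
  -- = 1.
  have hone := hmono Set.self_mem_Ici (Set.mem_Ici.2 zero_le_one) zero_lt_one
  have hlim := ge_of_tendsto (tendsto_sum_logPrimitive_sub a b)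
    ((eventually_ge_atTop 1).mono fun t ht =>
      hmono.monotoneOn (Set.mem_Ici.2 zero_le_one) (Set.mem_Ici.2 (zero_le_one.trans ht)) ht)
  simp only [logPrimitive_zero, sub_zero, Finset.sum_const_zero] at hone
  exact sub_pos.1 (pos_of_mul_pos_right (hone.trans_le hlim) Real.pi_pos.le)

end Comparison

end LogPrimitive

/-! ### Schur complements for blocks attached at one vertex -/

namespace Matrix

section Schur

variable {K m n : Type*} [Field K] [Fintype m] [DecidableEq m] [Fintype n] [DecidableEq n]

/-- The Schur complement sees A⁻¹ only through its entry at the attaching vertex. -/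
theorem det_fromBlocks_of_single_vertex_left (A : Matrix m m K) (B : Matrix m n K)
    (C : Matrix n m K) (D : Matrix n n K) (hA : A.det ≠ 0) (a : m)
    (hB : ∀ i k, i ≠ a → B i k = 0) (hC : ∀ k i, i ≠ a → C k i = 0) :
    (fromBlocks A B C D).det =
      A.det * (Matrix.of fun j k => D j k - C j a * A⁻¹ a a * B a k).det := by
  have hu : IsUnit A := (isUnit_iff_isUnit_det A).2 hA.isUnit
  let _ := hu.invertible
  rw [det_fromBlocks₁₁, invOf_eq_nonsing_inv]
  congr 2
  ext j k
  rw [sub_apply, mul_apply, Finset.sum_eq_single a (fun i _ hi => by rw [hB i k hi, mul_zero])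
    (by simp), mul_apply, Finset.sum_eq_single a (fun i _ hi => by rw [hC j i hi, zero_mul])
    (by simp)]
  rfl

theorem det_fromBlocks_of_single_vertex_right (A : Matrix m m K) (B : Matrix m n K)
    (C : Matrix n m K) (D : Matrix n n K) (hD : D.det ≠ 0) (b : n)
    (hB : ∀ k i, i ≠ b → B k i = 0) (hC : ∀ i k, i ≠ b → C i k = 0) :
    (fromBlocks A B C D).det =
      D.det * (Matrix.of fun j k => A j k - B j b * D⁻¹ b b * C b k).det := by
  have hu : IsUnit D := (isUnit_iff_isUnit_det D).2 hD.isUnit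
  let _ := hu.invertible
  rw [det_fromBlocks₂₂, invOf_eq_nonsing_inv]
  congr 2
  ext j k
  rw [sub_apply, mul_apply, Finset.sum_eq_single b (fun i _ hi => by rw [hC i k hi, mul_zero])
    (by simp), mul_apply, Finset.sum_eq_single b (fun i _ hi => by rw [hB j i hi, zero_mul])
    (by simp)]
  rfl

/-- Two matrices joined by a tridiagonal one, from the vertex `a` to the vertex `b`. -/
theorem det_joined_by_path {k : ℕ}
    (M : Matrix (m ⊕ Fin (k + 1) ⊕ n) (m ⊕ Fin (k + 1) ⊕ n) K) (a : m) (b : n) {t : K}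
    (hA : (M.submatrix Sum.inl Sum.inl).det ≠ 0)
    (hD : (M.submatrix (Sum.inr ∘ Sum.inr) (Sum.inr ∘ Sum.inr)).det ≠ 0)
    (hfar : ∀ i j, M (.inl i) (.inr (.inr j)) = 0 ∧ M (.inr (.inr j)) (.inl i) = 0)
    (hleft : ∀ i p, ¬ (i = a ∧ p.val = 0) →
      M (.inl i) (.inr (.inl p)) = 0 ∧ M (.inr (.inl p)) (.inl i) = 0)
    (hright : ∀ j p, ¬ (j = b ∧ p.val = k) →
      M (.inr (.inr j)) (.inr (.inl p)) = 0 ∧ M (.inr (.inl p)) (.inr (.inr j)) = 0)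
    (hla : M (.inr (.inl 0)) (.inl a) * M (.inl a) (.inr (.inl 0)) = -1)
    (hrb : M (.inr (.inl (Fin.last k))) (.inr (.inr b)) *
      M (.inr (.inr b)) (.inr (.inl (Fin.last k))) = -1)
    (htri : (M.submatrix (Sum.inr ∘ Sum.inl) (Sum.inr ∘ Sum.inl)).IsTridiagonal)
    (hdiag : ∀ p, M (.inr (.inl p)) (.inr (.inl p)) = t)
    (hoff : ∀ p q : Fin (k + 1), p.val + 1 = q.val →
      M (.inr (.inl p)) (.inr (.inl q)) * M (.inr (.inl q)) (.inr (.inl p)) = -1) :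
    M.det = (M.submatrix Sum.inl Sum.inl).det *
      (M.submatrix (Sum.inr ∘ Sum.inr) (Sum.inr ∘ Sum.inr)).det *
      (fibPoly t (k + 2) + ((M.submatrix Sum.inl Sum.inl)⁻¹ a a +
        (M.submatrix (Sum.inr ∘ Sum.inr) (Sum.inr ∘ Sum.inr))⁻¹ b b) * fibPoly t (k + 1) +
        (M.submatrix Sum.inl Sum.inl)⁻¹ a a *
        (M.submatrix (Sum.inr ∘ Sum.inr) (Sum.inr ∘ Sum.inr))⁻¹ b b * fibPoly t k) := by
  set A := M.submatrix Sum.inl Sum.inl with hAdef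
  set D := M.submatrix (Sum.inr ∘ Sum.inr) (Sum.inr ∘ Sum.inr) with hDdef
  have hM : M = fromBlocks A (M.submatrix Sum.inl Sum.inr) (M.submatrix Sum.inr Sum.inl)
      (M.submatrix Sum.inr Sum.inr) := (fromBlocks_toBlocks M).symm
  have h1 := det_fromBlocks_of_single_vertex_left A (M.submatrix Sum.inl Sum.inr)
    (M.submatrix Sum.inr Sum.inl) (M.submatrix Sum.inr Sum.inr) hA a
    (by
      rintro i (p | j) hi
      · exact (hleft i p (fun h => hi h.1)).1
      · exact (hfar i j).1)
    (by
      rintro (p | j) i hi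
      · exact (hleft i p (fun h => hi h.1)).2
      · exact (hfar i j).2)
  rw [← hM] at h1
  set N : Matrix (Fin (k + 1) ⊕ n) (Fin (k + 1) ⊕ n) K := Matrix.of fun j l =>
    M.submatrix Sum.inr Sum.inr j l -
      M.submatrix Sum.inr Sum.inl j a * A⁻¹ a a * M.submatrix Sum.inl Sum.inr a l with hN
  have hND : N.submatrix Sum.inr Sum.inr = D := by
    ext i j
    simp [hN, hDdef, (hfar a i).2]
  have hNfb : N = fromBlocks (N.submatrix Sum.inl Sum.inl) (N.submatrix Sum.inl Sum.inr)
      (N.submatrix Sum.inr Sum.inl) D := by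
    rw [← hND]
    exact (fromBlocks_toBlocks N).symm
  have hNr : ∀ j p, N (.inr j) (.inl p) = M (.inr (.inr j)) (.inr (.inl p)) ∧
      N (.inl p) (.inr j) = M (.inr (.inl p)) (.inr (.inr j)) := fun j p => by
    simp [hN, (hfar a j).1, (hfar a j).2]
  have h2 := det_fromBlocks_of_single_vertex_right (N.submatrix Sum.inl Sum.inl)
    (N.submatrix Sum.inl Sum.inr) (N.submatrix Sum.inr Sum.inl) D hD b
    (fun p j hj => (hNr j p).2.trans (hright j p fun h => hj h.1).2)
    (fun j p hj => (hNr j p).1.trans (hright j p fun h => hj h.1).1)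
  rw [← hNfb] at h2
  set T : Matrix (Fin (k + 1)) (Fin (k + 1)) K := Matrix.of fun p q =>
    N.submatrix Sum.inl Sum.inl p q -
      N.submatrix Sum.inl Sum.inr p b * D⁻¹ b b * N.submatrix Sum.inr Sum.inl b q with hT
  have hTapp : ∀ p q, T p q = M (.inr (.inl p)) (.inr (.inl q)) -
      M (.inr (.inl p)) (.inl a) * A⁻¹ a a * M (.inl a) (.inr (.inl q)) -
      M (.inr (.inl p)) (.inr (.inr b)) * D⁻¹ b b * M (.inr (.inr b)) (.inr (.inl q)) :=
    fun p q => by simp [hT, hN, (hfar a b).1, (hfar a b).2]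
  have hTne : ∀ p q, p ≠ q → T p q = M (.inr (.inl p)) (.inr (.inl q)) := by
    intro p q hpq
    have e1 : M (.inr (.inl p)) (.inl a) * A⁻¹ a a * M (.inl a) (.inr (.inl q)) = 0 := by
      by_cases hp : p.val = 0
      · rw [(hleft a q fun h => hpq (Fin.ext (hp.trans h.2.symm))).1, mul_zero]
      · rw [(hleft a p fun h => hp h.2).2, zero_mul, zero_mul]
    have e2 : M (.inr (.inl p)) (.inr (.inr b)) * D⁻¹ b b *
        M (.inr (.inr b)) (.inr (.inl q)) = 0 := by
      by_cases hp : p.val = k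
      · rw [(hright b q fun h => hpq (Fin.ext (hp.trans h.2.symm))).1, mul_zero]
      · rw [(hright b p fun h => hp h.2).2, zero_mul, zero_mul]
    rw [hTapp, e1, e2, sub_zero, sub_zero]
  have hTtri : T.IsTridiagonal := by
    intro p q h
    rw [hTne p q (by rintro rfl; omega)]
    exact htri p q h
  have h3 := hTtri.det_eq_fibPoly_of_ends (t := t) (x := A⁻¹ a a) (y := D⁻¹ b b)
    (by
      intro p
      have e1 : M (.inr (.inl p)) (.inl a) * A⁻¹ a a * M (.inl a) (.inr (.inl p)) =
          -- The two entries of the joining edge multiply to -1, so the subtracted Schur term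
          -- becomes +A⁻¹ a a at the end of the path.
          - if p.val = 0 then A⁻¹ a a else 0 := by
        split_ifs with hp
        · obtain rfl : p = 0 := Fin.ext hp
          linear_combination A⁻¹ a a * hla
        · rw [(hleft a p fun h => hp h.2).2]; simp
      have e2 : M (.inr (.inl p)) (.inr (.inr b)) * D⁻¹ b b *
          M (.inr (.inr b)) (.inr (.inl p)) = - if p.val = k then D⁻¹ b b else 0 := by
        split_ifs with hp
        · obtain rfl : p = Fin.last k := Fin.ext hp
          linear_combination D⁻¹ b b * hrb
        · rw [(hright b p fun h => hp h.2).2]; simp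
      rw [hTapp, e1, e2, hdiag]
      ring)
    (by
      intro p q h
      have hpq : p ≠ q := by rintro rfl; omega
      rw [hTne p q hpq, hTne q p hpq.symm]
      exact hoff p q h)
  rw [h1, h2, h3]
  ring

end Schur

/-! ### The Coulson matrix and its determinant on a cycle -/

/-- The matrix `t + i A`, whose determinant gives the integrand in Coulson's formula. -/
noncomputable def coulson {n : Type*} [DecidableEq n] (A : Matrix n n ℂ) (t : ℝ) : Matrix n n ℂ :=
  (t : ℂ) • (1 : Matrix n n ℂ) + Complex.I • A

theorem coulson_apply_self {n : Type*} [DecidableEq n] (A : Matrix n n ℂ) (t : ℝ) (i : n) :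
    A.coulson t i i = t + Complex.I * A i i := by
  simp [coulson]

theorem coulson_apply_ne {n : Type*} [DecidableEq n] (A : Matrix n n ℂ) (t : ℝ) {i j : n}
    (h : i ≠ j) : A.coulson t i j = Complex.I * A i j := by
  simp [coulson, h]

open Complex in
theorem IsHermitian.normSq_det_add_I_smul {n : Type*} [Fintype n] [DecidableEq n]
    {A : Matrix n n ℂ} (hA : A.IsHermitian) (t : ℝ) :
    normSq (A.coulson t).det = ∏ i, (hA.eigenvalues i ^ 2 + t ^ 2) := by
  -- Up to a factor of modulus 1, the determinant is the characteristic polynomial at it, and |it -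
  -- λ|² = λ² + t².
  have h : A.coulson t = (-I) • (scalar n (I * t) - A) := by
    ext i j
    by_cases hij : i = j
    · subst hij
      simp [coulson_apply_self]
      linear_combination (t : ℂ) * I_mul_I
    · simp [coulson_apply_ne A t hij, hij]
  rw [h, det_smul, ← eval_charpoly, hA.charpoly_eq, Polynomial.eval_prod, map_mul, map_pow,
    map_prod]
  simp [normSq_apply]
  refine Finset.prod_congr rfl fun i _ => by ring

section Cycle

open Complex SimpleGraph

variable {q : ℕ}

theorem _root_.SimpleGraph.cycleGraph_adj_iff_val {i j : Fin (q + 3)} (h : i.val < j.val) :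
    (cycleGraph (q + 3)).Adj i j ↔ i.val + 1 = j.val ∨ (i = 0 ∧ j = Fin.last _) := by
  have h1 : (j - i).val = j.val - i.val := Fin.sub_val_of_le (by exact h.le)
  have h2 : (i - j).val = q + 3 + i.val - j.val := Fin.coe_sub_iff_lt.2 h
  rw [cycleGraph_adj', h1, h2, Fin.ext_iff, Fin.ext_iff]
  simp only [Fin.val_zero, Fin.val_last]
  omega

variable {A : Matrix (Fin (q + 3)) (Fin (q + 3)) ℂ}

/-- The two orientations have conjugate gains, so only the real part remains. For odd length it is
multiplied by an odd power of i, hence is purely imaginary; the sign of that power is the sign in α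
and β. -/
theorem det_cycle_gain (hA : A.IsHermitian)
    (h0 : ∀ i j, ¬ (cycleGraph (q + 3)).Adj i j → A i j = 0)
    (h1 : ∀ i j, (cycleGraph (q + 3)).Adj i j → A i j * A j i = 1) (hq : Even q) (t : ℝ) :
    (A.coulson t).det =
      ((t * fibPoly t (q + 3) + 2 * fibPoly t (q + 2) : ℝ) : ℂ) -
        2 * I * ((-1) ^ ((q + 3 + 1) / 2) * (∏ i, A i (finRotate (q + 3) i)).re : ℝ) := by
  have hdiag : ∀ i, A i i = 0 := fun i => h0 i i (SimpleGraph.irrefl _)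
  have hne : ∀ i j, i ≠ j → (A.coulson t) i j = I * A i j :=
    fun i j h => coulson_apply_ne A t h
  have hprod : ∀ i j, (cycleGraph (q + 3)).Adj i j →
      (A.coulson t) i j * (A.coulson t) j i
        = -1 := by
    intro i j h
    rw [hne i j h.ne, hne j i h.ne']
    linear_combination (-1 : ℂ) * h1 i j h + A i j * A j i * I_mul_I
  have hgamma : ∏ i, A i (finRotate (q + 3) i) =
      (∏ i : Fin (q + 2), A i.castSucc i.succ) * A (Fin.last _) 0 := by
    rw [Fin.prod_univ_castSucc, finRotate_last]
    simp
  have hgamma' : (starRingEnd ℂ) (∏ i, A i (finRotate (q + 3) i)) =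
      (∏ i : Fin (q + 2), A i.succ i.castSucc) * A 0 (Fin.last _) := by
    rw [hgamma, map_mul, map_prod, ← hA.apply 0 (Fin.last _)]
    congr 1
    exact Finset.prod_congr rfl fun i _ => hA.apply _ _
  rw [det_cyclic_eq_fibPoly (t := (t : ℂ))]
  · have e1 : ∏ i : Fin (q + 2), (A.coulson t) i.castSucc i.succ =
        I ^ (q + 2) * ∏ i : Fin (q + 2), A i.castSucc i.succ := by
      rw [Finset.prod_congr rfl fun i _ => hne _ _ (Fin.castSucc_lt_succ (i := i)).ne,
        Finset.prod_mul_distrib]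
      simp
    have e2 : ∏ i : Fin (q + 2), (A.coulson t) i.succ i.castSucc =
        I ^ (q + 2) * ∏ i : Fin (q + 2), A i.succ i.castSucc := by
      rw [Finset.prod_congr rfl fun i _ => hne _ _ (Fin.castSucc_lt_succ (i := i)).ne',
        Finset.prod_mul_distrib]
      simp
    have hlast : (0 : Fin (q + 3)) ≠ Fin.last _ := (Fin.last_pos' ).ne
    rw [e1, e2, hne _ _ hlast, hne _ _ hlast.symm, fibPoly_ofReal, fibPoly_ofReal]
    have hre := re_eq_add_conj (∏ i, A i (finRotate (q + 3) i))
    rw [hgamma', hgamma] at hre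
    rw [hgamma]
    obtain ⟨p, rfl⟩ := hq
    have hdiv : (p + p + 3 + 1) / 2 = p + 2 := by omega
    have hI : I ^ (p + p + 2) = (-1) ^ (p + 1) := by
      rw [show p + p + 2 = 2 * (p + 1) by ring, pow_mul, I_sq]
    have hone : (-1 : ℂ) ^ (p + p) = 1 := Even.neg_one_pow ⟨p, rfl⟩
    push_cast
    rw [hre, hdiv, hI, hone]
    ring
  · intro i j h hc
    have hij : i ≠ j := by rintro rfl; omega
    have hnadj : ¬ (cycleGraph (q + 3)).Adj i j := by
      rw [cycleGraph_adj_iff_val (by omega)]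
      rintro (h' | h')
      · omega
      · exact hc.elim (fun h => h h'.1) (fun h => h h'.2)
    rw [hne i j hij, hne j i hij.symm, h0 i j hnadj, h0 j i (fun h => hnadj h.symm)]
    simp
  · intro i
    simp [coulson_apply_self, hdiag]
  · intro i j h
    exact hprod i j ((cycleGraph_adj_iff_val (by omega)).2 (Or.inl h))
  · exact hprod _ _ ((cycleGraph_adj_iff_val (by simp)).2 (Or.inr ⟨rfl, rfl⟩))

/-- Removing vertex 0 leaves a path on q + 2 vertices. -/
theorem adjugate_cycle_gain
    (h0 : ∀ i j, ¬ (cycleGraph (q + 3)).Adj i j → A i j = 0)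
    (h1 : ∀ i j, (cycleGraph (q + 3)).Adj i j → A i j * A j i = 1) (t : ℝ) :
    (A.coulson t).adjugate 0 0 = (fibPoly t (q + 3) : ℝ) := by
  rw [adjugate_fin_succ_eq_det_submatrix]
  have htri : ((A.coulson t).submatrix
      (Fin.succAbove 0) (Fin.succAbove 0)).IsTridiagonal := by
    have key : ∀ i j : Fin (q + 2), i.val + 1 < j.val →
        ¬ (cycleGraph (q + 3)).Adj i.succ j.succ := by
      intro i j h
      rw [cycleGraph_adj_iff_val (by simp; omega)]
      simp
      omega
    rintro i j (h | h)
    · have hij : i ≠ j := by rintro rfl; omega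
      simp [coulson_apply_ne A t (Fin.succ_injective _ |>.ne hij), h0 _ _ (key i j h)]
    · have hij : i ≠ j := by rintro rfl; omega
      simp [coulson_apply_ne A t (Fin.succ_injective _ |>.ne hij), h0 _ _ (fun h' => key j i h h'.symm)]
  rw [htri.det_eq_fibPoly (t := (t : ℂ)) (y := 0), fibPoly_ofReal]
  · simp
  · intro i
    simp [coulson_apply_self, h0 i.succ i.succ (SimpleGraph.irrefl _)]
  · intro i j h
    have hij : i ≠ j := by rintro rfl; omega
    have hadj : (cycleGraph (q + 3)).Adj i.succ j.succ :=
      (cycleGraph_adj_iff_val (by simp; omega)).2 (Or.inl (by simp; omega))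
    simp [coulson_apply_ne A t hadj.ne, coulson_apply_ne A t hadj.ne']
    linear_combination (-1 : ℂ) * h1 _ _ hadj + A i.succ j.succ * A j.succ i.succ * I_mul_I

end Cycle

end Matrix

/-! ### Gain graphs and the extremal choice of gains -/

namespace UnitGainGraph

variable {V : Type*} {G : SimpleGraph V} (Φ : UnitGainGraph G)

theorem adjMatrix_eq_zero {u v : V} (h : ¬ G.Adj u v) : Φ.adjMatrix u v = 0 := by
  simp [adjMatrix, h]

theorem adjMatrix_mul_adjMatrix {u v : V} (h : G.Adj u v) :
    Φ.adjMatrix u v * Φ.adjMatrix v u = 1 := by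
  have h2 : G.Adj v u := h.symm
  have h3 : Φ.gain ⟨(v, u), h2⟩ = (Φ.gain ⟨(u, v), h⟩)⁻¹ := Φ.gain_symm ⟨(u, v), h⟩
  simp only [adjMatrix, Matrix.of_apply]
  rw [dif_pos h, dif_pos h2, h3, ← Circle.coe_mul, mul_inv_cancel, Circle.coe_one]

theorem coulson_mul_coulson [DecidableEq V] {u v : V} (h : G.Adj u v) (t : ℝ) :
    Φ.adjMatrix.coulson t u v * Φ.adjMatrix.coulson t v u = -1 := by
  rw [Matrix.coulson_apply_ne _ t h.ne, Matrix.coulson_apply_ne _ t h.ne']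
  linear_combination (-1 : ℂ) * Φ.adjMatrix_mul_adjMatrix h +
    Φ.adjMatrix u v * Φ.adjMatrix v u * Complex.I_mul_I

theorem coulson_eq_zero [DecidableEq V] {u v : V} (huv : u ≠ v) (h : ¬ G.Adj u v) (t : ℝ) :
    Φ.adjMatrix.coulson t u v = 0 := by
  rw [Matrix.coulson_apply_ne _ t huv, Φ.adjMatrix_eq_zero h, mul_zero]

/-- The gain graph in which every oriented edge has gain `i` or `-i`, according to an ordering of
the vertices. -/
noncomputable def ofOrder (G : SimpleGraph V) {α : Type*} [LinearOrder α] (e : V ↪ α) :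
    UnitGainGraph G where
  gain d := if e d.fst < e d.snd then Circle.exp (Real.pi / 2) else (Circle.exp (Real.pi / 2))⁻¹
  gain_symm d := by
    have hne : e d.fst ≠ e d.snd := e.injective.ne d.adj.ne
    change (if e d.snd < e d.fst then _ else _) = _
    rcases hne.lt_or_gt with h | h
    · rw [if_neg h.not_gt, if_pos h]
    · rw [if_pos h, if_neg h.not_gt, inv_inv]

theorem exists_adjMatrix_ofOrder (G : SimpleGraph V) {α : Type*} [LinearOrder α] (e : V ↪ α)
    (u v : V) : ∃ x : ℝ, (ofOrder G e).adjMatrix u v = Complex.I * x := by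
  have hI : (Circle.exp (Real.pi / 2) : ℂ) = Complex.I := by
    rw [Circle.coe_exp]
    push_cast
    exact Complex.exp_pi_div_two_mul_I
  simp only [adjMatrix, Matrix.of_apply, ofOrder]
  split_ifs
  · exact ⟨1, by simp [hI]⟩
  · exact ⟨-1, by simp [hI]⟩
  · exact ⟨0, by simp⟩

/-- A product of an odd number of purely imaginary numbers is purely imaginary. -/
theorem re_prod_adjMatrix_ofOrder (G : SimpleGraph V) {α : Type*} [LinearOrder α] (e : V ↪ α)
    {n : ℕ} (hn : Odd n) (f g : Fin n → V) :
    (∏ i, (ofOrder G e).adjMatrix (f i) (g i)).re = 0 := by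
  choose x hx using exists_adjMatrix_ofOrder G e
  obtain ⟨p, rfl⟩ := hn
  rw [Finset.prod_congr rfl fun i _ => hx (f i) (g i), Finset.prod_mul_distrib,
    ← Complex.ofReal_prod]
  have hI : Complex.I ^ (2 * p + 1) = ((-1) ^ p : ℝ) * Complex.I := by
    rw [pow_succ, pow_mul, Complex.I_sq]
    push_cast
    rfl
  simp only [Finset.prod_const, Finset.card_univ, Fintype.card_fin]
  rw [hI, mul_assoc, Complex.re_ofReal_mul, Complex.re_mul_ofReal]
  simp

end UnitGainGraph

/-! ### The determinant of the dumbbell -/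

namespace Dumbbell

theorem exists_alpha_beta_eq_zero {r s : ℕ} (ℓ : ℕ) (hr : Odd r) (hs : Odd s) :
    ∃ Φ : UnitGainGraph (dumbbellGraph r s ℓ), alpha Φ = 0 ∧ beta Φ = 0 := by
  refine ⟨UnitGainGraph.ofOrder _ (Fintype.equivFin _).toEmbedding, ?_, ?_⟩
  · rw [alpha, gammaR, UnitGainGraph.re_prod_adjMatrix_ofOrder _ _ hr, mul_zero]
  · rw [beta, gammaS, UnitGainGraph.re_prod_adjMatrix_ofOrder _ _ hs, mul_zero]

variable {q u k : ℕ}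

/-- The value of `det (t + i A)` for the cycle of length `q + 3` with parameter `a`. -/
noncomputable def cycleValue (q : ℕ) (a t : ℝ) : ℂ :=
  ((t * fibPoly t (q + 3) + 2 * fibPoly t (q + 2) : ℝ) : ℂ) - 2 * Complex.I * (a : ℝ)

/-- The real part is positive; this makes the cycle blocks invertible, as the Schur complements
require. -/
theorem cycleValue_ne_zero (q : ℕ) (a : ℝ) {t : ℝ} (ht : 0 < t) : cycleValue q a t ≠ 0 := by
  intro h
  have hre := congrArg Complex.re h
  have h1 := fibPoly_succ_pos ht (q + 2)
  have h2 := fibPoly_succ_pos ht (q + 1)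
  simp [cycleValue] at hre
  nlinarith [mul_pos ht h1]

theorem coulson_inv_cycle {A : Matrix (Fin (q + 3)) (Fin (q + 3)) ℂ} (hA : A.IsHermitian)
    (h0 : ∀ i j, ¬ (SimpleGraph.cycleGraph (q + 3)).Adj i j → A i j = 0)
    (h1 : ∀ i j, (SimpleGraph.cycleGraph (q + 3)).Adj i j → A i j * A j i = 1) (hq : Even q)
    (t : ℝ) :
    (A.coulson t)⁻¹ 0 0 = (fibPoly t (q + 3) : ℝ) /
      cycleValue q ((-1) ^ ((q + 3 + 1) / 2) * (∏ i, A i (finRotate (q + 3) i)).re) t := by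
  rw [Matrix.inv_def, Matrix.smul_apply, Matrix.adjugate_cycle_gain h0 h1,
    Matrix.det_cycle_gain hA h0 h1 hq, Ring.inverse_eq_inv, smul_eq_mul, cycleValue, div_eq_inv_mul]

theorem det_coulson (Φ : UnitGainGraph (dumbbellGraph (q + 3) (u + 3) (k + 2)))
    (hq : Even q) (hu : Even u) {t : ℝ} (ht : 0 < t) :
    (Φ.adjMatrix.coulson t).det =
      cycleValue q (alpha Φ) t * cycleValue u (beta Φ) t * (fibPoly t (k + 2) : ℝ) +
      (fibPoly t (q + 3) * cycleValue u (beta Φ) t + fibPoly t (u + 3) * cycleValue q (alpha Φ) t) *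
        (fibPoly t (k + 1) : ℝ) +
      (fibPoly t (q + 3) * fibPoly t (u + 3) * fibPoly t k : ℝ) := by
  have hR : (Φ.adjMatrix.coulson t).submatrix Sum.inl Sum.inl =
      (Φ.adjMatrix.submatrix Sum.inl Sum.inl).coulson t := by
    ext i j
    simp [Matrix.coulson, Matrix.one_apply]
  have hS : (Φ.adjMatrix.coulson t).submatrix (Sum.inr ∘ Sum.inr) (Sum.inr ∘ Sum.inr) =
      (Φ.adjMatrix.submatrix (Sum.inr ∘ Sum.inr) (Sum.inr ∘ Sum.inr)).coulson t := by
    ext i j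
    simp [Matrix.coulson, Matrix.one_apply]
  have hRherm : (Φ.adjMatrix.submatrix Sum.inl Sum.inl).IsHermitian :=
    Φ.adjMatrix_isHermitian.submatrix _
  have hSherm : (Φ.adjMatrix.submatrix (Sum.inr ∘ Sum.inr) (Sum.inr ∘ Sum.inr)).IsHermitian :=
    Φ.adjMatrix_isHermitian.submatrix _
  have hR0 : ∀ i j, ¬ (SimpleGraph.cycleGraph (q + 3)).Adj i j →
      Φ.adjMatrix.submatrix Sum.inl Sum.inl i j = 0 := fun i j h => Φ.adjMatrix_eq_zero h
  have hR1 : ∀ i j, (SimpleGraph.cycleGraph (q + 3)).Adj i j →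
      Φ.adjMatrix.submatrix Sum.inl Sum.inl i j * Φ.adjMatrix.submatrix Sum.inl Sum.inl j i = 1 :=
    fun i j h => Φ.adjMatrix_mul_adjMatrix (u := Sum.inl i) (v := Sum.inl j) h
  have hS0 : ∀ i j, ¬ (SimpleGraph.cycleGraph (u + 3)).Adj i j →
      Φ.adjMatrix.submatrix (Sum.inr ∘ Sum.inr) (Sum.inr ∘ Sum.inr) i j = 0 :=
    fun i j h => Φ.adjMatrix_eq_zero h
  have hS1 : ∀ i j, (SimpleGraph.cycleGraph (u + 3)).Adj i j →
      Φ.adjMatrix.submatrix (Sum.inr ∘ Sum.inr) (Sum.inr ∘ Sum.inr) i j *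
      Φ.adjMatrix.submatrix (Sum.inr ∘ Sum.inr) (Sum.inr ∘ Sum.inr) j i = 1 :=
    fun i j h => Φ.adjMatrix_mul_adjMatrix (u := Sum.inr (Sum.inr i)) (v := Sum.inr (Sum.inr j)) h
  have hRdet : ((Φ.adjMatrix.coulson t).submatrix Sum.inl Sum.inl).det =
      cycleValue q (alpha Φ) t := by
    rw [hR]
    exact Matrix.det_cycle_gain hRherm hR0 hR1 hq t
  have hSdet : ((Φ.adjMatrix.coulson t).submatrix (Sum.inr ∘ Sum.inr) (Sum.inr ∘ Sum.inr)).det =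
      cycleValue u (beta Φ) t := by
    rw [hS]
    exact Matrix.det_cycle_gain hSherm hS0 hS1 hu t
  have hRinv : ((Φ.adjMatrix.coulson t).submatrix Sum.inl Sum.inl)⁻¹ 0 0 =
      (fibPoly t (q + 3) : ℝ) / cycleValue q (alpha Φ) t := by
    rw [hR]
    exact coulson_inv_cycle hRherm hR0 hR1 hq t
  have hSinv : ((Φ.adjMatrix.coulson t).submatrix (Sum.inr ∘ Sum.inr) (Sum.inr ∘ Sum.inr))⁻¹ 0 0 =
      (fibPoly t (u + 3) : ℝ) / cycleValue u (beta Φ) t := by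
    rw [hS]
    exact coulson_inv_cycle hSherm hS0 hS1 hu t
  have hRne := cycleValue_ne_zero q (alpha Φ) ht
  have hSne := cycleValue_ne_zero u (beta Φ) ht
  have key := Matrix.det_joined_by_path (m := Fin (q + 3)) (n := Fin (u + 3)) (k := k)
    (Φ.adjMatrix.coulson t) 0 0 (t := (t : ℂ)) (by rw [hRdet]; exact hRne)
    (by rw [hSdet]; exact hSne)
    (fun i j => ⟨Φ.coulson_eq_zero (by simp) (by rintro ⟨h, -⟩; omega) t,
      Φ.coulson_eq_zero (by simp) (by rintro ⟨h, -⟩; omega) t⟩)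
    (fun i p hip => ⟨Φ.coulson_eq_zero (by simp) (by exact fun h => hip ⟨Fin.ext h.1, h.2⟩) t,
      Φ.coulson_eq_zero (by simp) (by exact fun h => hip ⟨Fin.ext h.1, h.2⟩) t⟩)
    (fun j p hjp => ⟨Φ.coulson_eq_zero (by simp)
        (by rintro ⟨h, h'⟩; exact hjp ⟨Fin.ext h', by omega⟩) t,
      Φ.coulson_eq_zero (by simp) (by rintro ⟨h, h'⟩; exact hjp ⟨Fin.ext h', by omega⟩) t⟩)
    (Φ.coulson_mul_coulson (by exact ⟨rfl, rfl⟩) t)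
    (Φ.coulson_mul_coulson (by exact ⟨rfl, rfl⟩) t)
    (by
      intro i j h
      refine Φ.coulson_eq_zero ?_ (fun h' => ?_) t
      · simp only [Function.comp_apply, Ne, Sum.inr.injEq, Sum.inl.injEq]
        rintro rfl
        omega
      · have := SimpleGraph.pathGraph_adj.1 h'
        omega)
    (fun p => by
      rw [Matrix.coulson_apply_self, Φ.adjMatrix_eq_zero (SimpleGraph.irrefl _), mul_zero,
        add_zero])
    (fun p p' h => Φ.coulson_mul_coulson (by exact SimpleGraph.pathGraph_adj.2 (Or.inl h)) t)
  rw [hRdet, hSdet, hRinv, hSinv, fibPoly_ofReal, fibPoly_ofReal, fibPoly_ofReal] at key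
  rw [key]
  push_cast
  field_simp

/-! ### Pointwise minimality at (0, 0) and the energy -/

/-- The value of `∏ (λ ^ 2 + t ^ 2)`, over the eigenvalues `λ`, at the parameters `(0, 0)`. -/
noncomputable def baseValue (q u k : ℕ) (t : ℝ) : ℝ :=
  (t * fibPoly t (q + 3) + 2 * fibPoly t (q + 2)) *
    (t * fibPoly t (u + 3) + 2 * fibPoly t (u + 2)) * fibPoly t (k + 2) +
  (fibPoly t (q + 3) * (t * fibPoly t (u + 3) + 2 * fibPoly t (u + 2)) +
    fibPoly t (u + 3) * (t * fibPoly t (q + 3) + 2 * fibPoly t (q + 2))) * fibPoly t (k + 1) +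
  fibPoly t (q + 3) * fibPoly t (u + 3) * fibPoly t k

theorem normSq_expand (g h x y f₂ f₁ f₀ a b : ℝ) :
    Complex.normSq (((g : ℂ) - 2 * Complex.I * (a : ℝ)) * ((h : ℂ) - 2 * Complex.I * (b : ℝ)) *
      (f₂ : ℂ) + (x * ((h : ℂ) - 2 * Complex.I * (b : ℝ)) +
        y * ((g : ℂ) - 2 * Complex.I * (a : ℝ))) * f₁ + (x * y * f₀ : ℝ)) =
    (g * h * f₂ + (x * h + y * g) * f₁ + x * y * f₀) ^ 2 + 16 * (a * b * f₂) ^ 2 +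
      4 * (a * (h * f₂ + y * f₁)) ^ 2 + 4 * (b * (g * f₂ + x * f₁)) ^ 2 +
      8 * (a * b) * (x * y) * (f₁ ^ 2 - f₂ * f₀) := by
  rw [Complex.normSq_apply]
  simp
  ring

/-- By the arithmetic-geometric mean inequality the squares dominate 8|ab|AB, which exceeds the
cross term unless ab = 0. -/
theorem weighted_sq_pos {A B c a b : ℝ} (hA : 0 < A) (hB : 0 < B) (hc : |c| < A * B)
    (hab : ¬ (a = 0 ∧ b = 0)) :
    0 < 4 * (a * A) ^ 2 + 4 * (b * B) ^ 2 + 8 * (a * b) * c := by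
  by_cases h : a * b = 0
  · rw [h]
    rcases mul_eq_zero.1 h with rfl | rfl
    · have : b ≠ 0 := fun hb => hab ⟨rfl, hb⟩
      have : 0 < (b * B) ^ 2 := by positivity
      linarith [sq_nonneg (0 * A)]
    · have : a ≠ 0 := fun ha => hab ⟨ha, rfl⟩
      have : 0 < (a * A) ^ 2 := by positivity
      linarith [sq_nonneg (0 * B)]
  · have hpos : 0 < |a * b| := abs_pos.2 h
    have h1 : -(|a * b| * |c|) ≤ a * b * c := by
      rw [← abs_mul]
      exact neg_abs_le _
    have h2 : |a * b| * |c| < |a * b| * (A * B) := mul_lt_mul_of_pos_left hc hpos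
    have h3 : 0 ≤ (|a| * A - |b| * B) ^ 2 := sq_nonneg _
    have h4 : (|a| * A - |b| * B) ^ 2 = (a * A) ^ 2 + (b * B) ^ 2 - 2 * (|a * b| * (A * B)) := by
      rw [abs_mul, sub_sq, mul_pow, mul_pow, sq_abs, sq_abs]
      ring
    nlinarith

theorem prod_eigenvalues (Φ : UnitGainGraph (dumbbellGraph (q + 3) (u + 3) (k + 2)))
    (hq : Even q) (hu : Even u) (hk : Even k) {t : ℝ} (ht : 0 < t) :
    ∏ i, (Φ.adjMatrix_isHermitian.eigenvalues i ^ 2 + t ^ 2) =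
      baseValue q u k t ^ 2 + 16 * (alpha Φ * beta Φ * fibPoly t (k + 2)) ^ 2 +
      (4 * (alpha Φ * ((t * fibPoly t (u + 3) + 2 * fibPoly t (u + 2)) * fibPoly t (k + 2) +
        fibPoly t (u + 3) * fibPoly t (k + 1))) ^ 2 +
      4 * (beta Φ * ((t * fibPoly t (q + 3) + 2 * fibPoly t (q + 2)) * fibPoly t (k + 2) +
        fibPoly t (q + 3) * fibPoly t (k + 1))) ^ 2 +
      8 * (alpha Φ * beta Φ) * (fibPoly t (q + 3) * fibPoly t (u + 3))) := by
  rw [← Φ.adjMatrix_isHermitian.normSq_det_add_I_smul t, det_coulson Φ hq hu ht, cycleValue,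
    cycleValue, normSq_expand, fibPoly_cassini, hk.neg_one_pow, baseValue]
  ring

theorem sq_baseValue_lt_prod (Φ : UnitGainGraph (dumbbellGraph (q + 3) (u + 3) (k + 2)))
    (hq : Even q) (hu : Even u) (hk : Even k) (h : ¬ (alpha Φ = 0 ∧ beta Φ = 0)) {t : ℝ}
    (ht : 0 < t) :
    baseValue q u k t ^ 2 < ∏ i, (Φ.adjMatrix_isHermitian.eigenvalues i ^ 2 + t ^ 2) := by
  have hx := fibPoly_succ_pos ht (q + 2)
  have hy := fibPoly_succ_pos ht (u + 2)
  have hx' := fibPoly_succ_pos ht (q + 1)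
  have hy' := fibPoly_succ_pos ht (u + 1)
  have h2 := fibPoly_succ_pos ht (k + 1)
  have h1 := fibPoly_succ_pos ht k
  have h0 := fibPoly_nonneg ht k
  have hcas := fibPoly_cassini t k
  rw [hk.neg_one_pow] at hcas
  have hdiff : 0 < baseValue q u k t * fibPoly t (k + 2) := by
    rw [baseValue]
    positivity
  have hw := weighted_sq_pos (a := alpha Φ) (b := beta Φ)
    (A := (t * fibPoly t (u + 3) + 2 * fibPoly t (u + 2)) * fibPoly t (k + 2) +
        fibPoly t (u + 3) * fibPoly t (k + 1))
    (B := (t * fibPoly t (q + 3) + 2 * fibPoly t (q + 2)) * fibPoly t (k + 2) +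
        fibPoly t (q + 3) * fibPoly t (k + 1))
    (c := fibPoly t (q + 3) * fibPoly t (u + 3)) (by positivity) (by positivity)
    (by
      rw [abs_of_pos (by positivity)]
      rw [baseValue] at hdiff
      -- AB - c equals `baseValue` times F_{k+2}, because the sign in Cassini's identity is +1 for
      -- even k.
      linear_combination hdiff - fibPoly t (q + 3) * fibPoly t (u + 3) * hcas)
    h
  rw [prod_eigenvalues Φ hq hu hk ht]
  have := sq_nonneg (alpha Φ * beta Φ * fibPoly t (k + 2))
  linarith

theorem prod_eq_sq_baseValue (Φ : UnitGainGraph (dumbbellGraph (q + 3) (u + 3) (k + 2)))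
    (hq : Even q) (hu : Even u) (hk : Even k) (ha : alpha Φ = 0) (hb : beta Φ = 0) {t : ℝ}
    (ht : 0 < t) :
    ∏ i, (Φ.adjMatrix_isHermitian.eigenvalues i ^ 2 + t ^ 2) = baseValue q u k t ^ 2 := by
  rw [prod_eigenvalues Φ hq hu hk ht, ha, hb]
  ring

theorem energy_lt_energy (Φ Ψ : UnitGainGraph (dumbbellGraph (q + 3) (u + 3) (k + 2)))
    (hq : Even q) (hu : Even u) (hk : Even k) (ha : alpha Φ = 0) (hb : beta Φ = 0)
    (h : ¬ (alpha Ψ = 0 ∧ beta Ψ = 0)) : Φ.energy < Ψ.energy :=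
  sum_abs_lt_of_prod_sq_add_sq_lt fun _ ht => by
    rw [prod_eq_sq_baseValue Φ hq hu hk ha hb ht]
    exact sq_baseValue_lt_prod Ψ hq hu hk h ht

theorem energy_le_energy (Φ Ψ : UnitGainGraph (dumbbellGraph (q + 3) (u + 3) (k + 2)))
    (hq : Even q) (hu : Even u) (hk : Even k) (ha : alpha Φ = 0) (hb : beta Φ = 0) :
    Φ.energy ≤ Ψ.energy := by
  by_cases h : alpha Ψ = 0 ∧ beta Ψ = 0
  · refine sum_abs_le_of_prod_sq_add_sq_le fun t ht => ?_
    rw [prod_eq_sq_baseValue Φ hq hu hk ha hb ht, prod_eq_sq_baseValue Ψ hq hu hk h.1 h.2 ht]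
  · exact (energy_lt_energy Φ Ψ hq hu hk ha hb h).le

end Dumbbell

theorem mainTheorem6 (r s ℓ : ℕ) (hr : 3 ≤ r) (hs : 3 ≤ s) (hℓ : 1 ≤ ℓ)
    (hr_odd : Odd r) (hs_odd : Odd s) (hℓ_even : Even ℓ) :
    (∃ Φ : UnitGainGraph (dumbbellGraph r s ℓ),
      ∀ Ψ : UnitGainGraph (dumbbellGraph r s ℓ), Φ.energy ≤ Ψ.energy) ∧
    ∀ Φ : UnitGainGraph (dumbbellGraph r s ℓ),
      (∀ Ψ : UnitGainGraph (dumbbellGraph r s ℓ), Φ.energy ≤ Ψ.energy) ↔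
        (Dumbbell.alpha Φ, Dumbbell.beta Φ) = (0, 0) := by
  obtain ⟨Φ₀, ha, hb⟩ := Dumbbell.exists_alpha_beta_eq_zero ℓ hr_odd hs_odd
  obtain ⟨q, rfl⟩ := Nat.exists_eq_add_of_le' hr
  obtain ⟨u, rfl⟩ := Nat.exists_eq_add_of_le' hs
  -- Evenness excludes ℓ = 1, so the path has an inner vertex and the indices k, k + 1, k + 2 make
  -- sense.
  have hℓ2 : 2 ≤ ℓ := by
    obtain ⟨p, rfl⟩ := hℓ_even
    omega
  obtain ⟨k, rfl⟩ := Nat.exists_eq_add_of_le' hℓ2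
  have hq : Even q := by
    rcases hr_odd with ⟨p, hp⟩
    exact ⟨p - 1, by omega⟩
  have hu : Even u := by
    rcases hs_odd with ⟨p, hp⟩
    exact ⟨p - 1, by omega⟩
  have hk : Even k := by
    rcases hℓ_even with ⟨p, hp⟩
    exact ⟨p - 1, by omega⟩
  refine ⟨⟨Φ₀, fun Ψ => Dumbbell.energy_le_energy Φ₀ Ψ hq hu hk ha hb⟩, fun Φ => ?_⟩
  rw [Prod.mk.injEq]
  refine ⟨fun hmin => ?_, fun h Ψ => Dumbbell.energy_le_energy Φ Ψ hq hu hk h.1 h.2⟩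
  by_contra h
  exact (Dumbbell.energy_lt_energy Φ₀ Φ hq hu hk ha hb h).not_ge (hmin Φ₀)
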